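/- Let $\Gamma$ be a finite directed graph without self-loops on the node set $\{1,\dots,L\}$. A matrix $G=(G_{kj})$ of real rational functions of $z$ is *consistent* with $\Gamma$ if $G_{kj}\neq 0$ only when $(j,k)$ is an edge. A *network matrix consistent with $\Gamma$* is a consistent $G$ with proper rational entries that is well-posed, i.e. $(I-G)^{-1}$ exists and is proper and stable (all poles in the open unit disc). A *rational transfer matrix parametrization* consistent with $\Gamma$ is given by integers $p_{kj},n_{kj}\ge 0$ for every edge $(j,k)$; with the vector $P\in\mathbb{R}^{N}$ of all real parameters $\kappa_{kj},\alpha_{kj}^{(m)},\beta_{kj}^{(m)}$ $(0\le m<n_{kj})$ it defines the matrix $G(P,z)$ with entries $$G_{kj}(P,z)=\kappa_{kj}\,z^{-p_{kj}}\,\frac{z^{n_{kj}}+\sum_{m<n_{kj}}\beta_{kj}^{(m)}z^{m}}{z^{n_{kj}}+\sum_{m<n_{kj}}\alpha_{kj}^{(m)}z^{m}}$$ on the edges $(j,k)$ and $0$ elsewhere. Let $C$ be a matrix each of whose rows has one entry $1$ and all other entries $0$, and let $\mathcal C$ be the set of (measured) nodes that it selects. For sets of nodes $\mathcal A,\mathcal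 B$ let $b_{\mathcal A\to\mathcal B}$ be the maximum number of mutually vertex-disjoint directed paths starting in $\mathcal A$ and ending in $\mathcal B$ (a single node counts as a path; paths do not repeat nodes). Fix a node $i$ with set of out-neighbours $N_i^+$, a subset $N_i^*\subseteq N_i^+$, and put $\bar N_i^*=N_i^+\setminus N_i^*$. We say that the transfer functions on the edges from $i$ to $N_i^*$ are *generically identifiable* from $\mathcal C$ if, for every rational transfer matrix parametrization $G(P,z)$ consistent with $\Gamma$, the following holds for all $P$ outside a set of Lebesgue measure zero: for every network matrix $\tilde G$ consistent with $\Gamma$, $$C(I-G(P,z))^{-1}=C(I-\tilde G(z))^{-1}\ \Longrightarrow\ G_{ji}(P,z)=\tilde G_{ji}(z)\quad\text{for all } j\in N_i^*.$$ **Theorem.** The transfer functions on the edges from $i$ to $N_i^*$ are generically identifiable from $\mathcal C$ if and only if $$b_{N_i^*\to\mathcal C}=|N_i^*|\qquad\text{and}\qquad b_{N_i^+\to\mathcal C}=|N_i^*|+b_{\bar N_i^*\to\mathcal C}.$$ The same equivalence holds if, in the definition of generic identifiability, $\tilde G$ ranges instead over all matrices of real rational functions consistent with $\Gamma$ that solve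 $C(I-G(P,z))^{-1}(I-\tilde G(z))=C$. -/

import Mathlib

open MeasureTheory Polynomial

noncomputable section

/-! ### Directed graphs: out-neighbours, paths, vertex-disjoint paths -/

open scoped Classical in
/-- The set `N_i^+` of out-neighbours of a node: all `j` such that `(i, j)` is an edge. -/
def outNbrs {V : Type*} [Fintype V] (Γ : Digraph V) (i : V) : Finset V :=
  Finset.univ.filter fun j => Γ.Adj i j

/-- `l` is the vertex sequence of a path of `Γ` that starts in `A` and ends in `B`: consecutive
vertices are joined by edges and no vertex is visited twice. A single vertex is a (trivial) path. -/
structure IsPathFromTo {V : Type*} (Γ : Digraph V) (A B : Finset V) (l : List V) : Prop where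
  chain : l.IsChain Γ.Adj
  nodup : l.Nodup
  start_mem : ∃ a ∈ l.head?, a ∈ A
  end_mem : ∃ b ∈ l.getLast?, b ∈ B

/-- `S` is a group of mutually vertex-disjoint paths from `A` to `B`. -/
def IsDisjointPathFamily {V : Type*} (Γ : Digraph V) (A B : Finset V) (S : Finset (List V)) :
    Prop :=
  (∀ l ∈ S, IsPathFromTo Γ A B l) ∧ (S : Set (List V)).Pairwise List.Disjoint

/-- `b_{A → B}`: the maximum number of mutually vertex-disjoint paths from `A` to `B`. -/
def maxDisjointPaths {V : Type*} (Γ : Digraph V) (A B : Finset V) : ℕ :=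
  sSup {k | ∃ S : Finset (List V), IsDisjointPathFamily Γ A B S ∧ S.card = k}

/-- The supremum defining `b_{A → B}` is an attained maximum. -/
theorem isGreatest_maxDisjointPaths {V : Type*} [Fintype V] (Γ : Digraph V) (A B : Finset V) :
    IsGreatest {k | ∃ S : Finset (List V), IsDisjointPathFamily Γ A B S ∧ S.card = k}
      (maxDisjointPaths Γ A B) := by
  have hne : {k | ∃ S : Finset (List V), IsDisjointPathFamily Γ A B S ∧ S.card = k}.Nonempty :=
    ⟨0, ∅, ⟨by simp, by simp⟩, rfl⟩
  have hbdd : BddAbove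
      {k | ∃ S : Finset (List V), IsDisjointPathFamily Γ A B S ∧ S.card = k} := by
    refine ⟨Fintype.card V, ?_⟩
    rintro k ⟨S, ⟨hS, hd⟩, rfl⟩
    have h : ∀ l : S, ∃ a : V, a ∈ l.1 := fun l => by
      obtain ⟨a, ha, -⟩ := (hS l.1 l.2).start_mem
      exact ⟨a, List.mem_of_mem_head? ha⟩
    choose f hf using h
    have hinj : Function.Injective f := by
      intro l l' hll
      by_contra hne'
      have := hd l.2 l'.2 (fun h => hne' (Subtype.ext h))
      exact this (hf l) (hll ▸ hf l')
    simpa using Fintype.card_le_of_injective f hinj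
  exact ⟨Nat.sSup_mem hne hbdd, fun k hk => le_csSup hbdd hk⟩

/-! ### Network matrices -/

/-- A real rational function of `z` is proper: its numerator has degree at most that of its
denominator. -/
def IsProperTF (g : RatFunc ℝ) : Prop := g.num.natDegree ≤ g.denom.natDegree

/-- A (discrete-time) rational transfer function is stable: all its poles lie in the open unit
disc. -/
def IsStableTF (g : RatFunc ℝ) : Prop := ∀ z : ℂ, aeval z g.denom = 0 → ‖z‖ < 1

/-- `G` is consistent with the graph: `G k j` can be nonzero only if `(j, k)` is an edge. -/
def IsConsistent {V : Type*} (Γ : Digraph V) (G : Matrix V V (RatFunc ℝ)) : Prop :=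
  ∀ j k, ¬ Γ.Adj j k → G k j = 0

/-- `G` is a network matrix consistent with the graph: its entries are proper rational transfer
functions and the network is well-posed, that is, `(I - G)⁻¹` exists and is proper and stable. -/
structure IsNetworkMatrix {V : Type*} [Fintype V] [DecidableEq V] (Γ : Digraph V)
    (G : Matrix V V (RatFunc ℝ)) : Prop where
  consistent : IsConsistent Γ G
  proper : ∀ k j, IsProperTF (G k j)
  isUnit : IsUnit (1 - G)
  inv_proper : ∀ k j, IsProperTF ((1 - G)⁻¹ k j)
  inv_stable : ∀ k j, IsStableTF ((1 - G)⁻¹ k j)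

/-! ### Parametrizations and generic properties -/

/-- The edges of a directed graph, as ordered pairs (tail, head). -/
abbrev GraphEdge {V : Type*} (Γ : Digraph V) : Type _ := {e : V × V // Γ.Adj e.1 e.2}

/-- The integer data of a rational transfer matrix parametrization: for every edge a delay `p`
and an order `n`. -/
structure TFParametrization {V : Type*} (Γ : Digraph V) where
  p : GraphEdge Γ → ℕ
  n : GraphEdge Γ → ℕ

namespace TFParametrization

variable {V : Type*} {Γ : Digraph V}

/-- The index set of all real parameters: for every edge `e` one gain, `n e` numerator
coefficients and `n e` denominator coefficients. -/
abbrev Index (π : TFParametrization Γ) : Type _ :=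
  Σ e : GraphEdge Γ, Unit ⊕ Fin (π.n e) ⊕ Fin (π.n e)

instance [Finite V] (π : TFParametrization Γ) : Fintype π.Index := Fintype.ofFinite _

/-- The gain of the edge `e`. -/
def kappa (π : TFParametrization Γ) (P : π.Index → ℝ) (e : GraphEdge Γ) : ℝ :=
  P ⟨e, Sum.inl ()⟩

/-- The coefficients of the numerator of the edge `e`. -/
def beta (π : TFParametrization Γ) (P : π.Index → ℝ) (e : GraphEdge Γ) (m : Fin (π.n e)) : ℝ :=
  P ⟨e, Sum.inr (Sum.inl m)⟩

/-- The coefficients of the denominator of the edge `e`. -/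
def alpha (π : TFParametrization Γ) (P : π.Index → ℝ) (e : GraphEdge Γ) (m : Fin (π.n e)) : ℝ :=
  P ⟨e, Sum.inr (Sum.inr m)⟩

/-- The transfer function of the edge `e` at the parameter `P`:
`κ z ^ (-p) (z ^ n + ∑ m < n, β_m z ^ m) / (z ^ n + ∑ m < n, α_m z ^ m)`. -/
def entry (π : TFParametrization Γ) (P : π.Index → ℝ) (e : GraphEdge Γ) : RatFunc ℝ :=
  RatFunc.C (π.kappa P e) * (RatFunc.X ^ π.p e)⁻¹ *
    (algebraMap ℝ[X] (RatFunc ℝ) (X ^ π.n e + ∑ m, C (π.beta P e m) * X ^ (m : ℕ)) /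
      algebraMap ℝ[X] (RatFunc ℝ) (X ^ π.n e + ∑ m, C (π.alpha P e m) * X ^ (m : ℕ)))

open scoped Classical in
/-- The transfer matrix `G(P, z)`; its `(k, j)` entry belongs to the edge `(j, k)` and is zero if
there is no such edge. -/
def toMatrix (π : TFParametrization Γ) (P : π.Index → ℝ) : Matrix V V (RatFunc ℝ) :=
  fun k j => if h : Γ.Adj j k then π.entry P ⟨(j, k), h⟩ else 0

end TFParametrization

/-- A property of transfer matrices holds generically for the graph: for every rational transfer
matrix parametrization consistent with the graph it holds for `G(P, z)`, for all parameter vectors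
`P` except those in a set of Lebesgue measure zero. -/
def HoldsGenerically {V : Type*} [Fintype V] (Γ : Digraph V)
    (Q : Matrix V V (RatFunc ℝ) → Prop) : Prop :=
  ∀ π : TFParametrization Γ, ∀ᵐ P : π.Index → ℝ, Q (π.toMatrix P)

/-! ### Identifiability -/

/-- The matrix `C` selecting the measured nodes: row `r` has its only nonzero entry, equal to `1`,
in the column `sel r`. -/
def selectionMatrix {V : Type*} [DecidableEq V] {m : ℕ} (sel : Fin m → V) :
    Matrix (Fin m) V (RatFunc ℝ) :=
  fun r v => if v = sel r then 1 else 0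

/-- The transfer functions of `G` on the edges from `i` to the nodes of `N` are identifiable from
the measured nodes: every network matrix `G'` consistent with the graph such that
`C (I - G)⁻¹ = C (I - G')⁻¹` has the same transfer functions on these edges. -/
def EdgesIdentifiable {V : Type*} [Fintype V] [DecidableEq V] (Γ : Digraph V) {m : ℕ}
    (sel : Fin m → V) (i : V) (N : Finset V) (G : Matrix V V (RatFunc ℝ)) : Prop :=
  ∀ G' : Matrix V V (RatFunc ℝ), IsNetworkMatrix Γ G' →
    selectionMatrix sel * (1 - G)⁻¹ = selectionMatrix sel * (1 - G')⁻¹ →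
    ∀ j ∈ N, G j i = G' j i

/-- Identifiability as uniqueness of the solution of `C T (I - G') = C`, where `T = (I - G)⁻¹`,
among all matrices `G'` of rational functions that are consistent with the graph. -/
def EdgesIdentifiableAmongSolutions {V : Type*} [Fintype V] [DecidableEq V] (Γ : Digraph V) {m : ℕ}
    (sel : Fin m → V) (i : V) (N : Finset V) (G : Matrix V V (RatFunc ℝ)) : Prop :=
  ∀ G' : Matrix V V (RatFunc ℝ), IsConsistent Γ G' →
    selectionMatrix sel * (1 - G)⁻¹ * (1 - G') = selectionMatrix sel →
    ∀ j ∈ N, G j i = G' j i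

end

/-!
Two consistent matrices with the same measured data differ, in the column of the node `i`, by a
linear relation among the columns of `C T`, `T = (1 - G)⁻¹`, that belong to the out-neighbours of
`i`. So the edges from `i` to `N` are determined by `C T` as soon as every such relation vanishes on
`N`, which says that `N` adds `#N` to the rank of the columns of the remaining out-neighbours
(`coeff_eq_zero_of_finrank_span_union`, `finrank_span_union_of_coeff_eq_zero`). The theorem thus
rests on one fact, `TFParametrization.ae_measuredRank_eq`: for almost all parameters, the rank of
the columns of `C T` with indices in `A` equals the maximum number of disjoint paths from `A` to
the measured nodes.

A minor of `T` is nonzero exactly when the matrix `1 - G`, bordered by the corresponding unit rows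
and columns, has nonzero determinant. This reduces both inequalities to determinants:

* If the determinant is nonzero, some term of its Leibniz expansion is nonzero. Its permutation
  moves nodes along edges, and following its orbits between the bordering indices gives disjoint
  paths (`card_le_maxDisjointPaths_of_det_ne_zero`). No form of Menger's theorem is needed.
* Given disjoint paths, switching on exactly their edges makes the bordered matrix nonsingular
  (`det_borderedMatrix_ne_zero_of_isDisjointPathFamily`). With denominators cleared, the
  determinant is a polynomial in the parameters and `z`, and a polynomial that is nonzero at one
  parameter vector is nonzero at almost all of them (`ae_evalParam_ne_zero`).

Conversely, when the rank condition fails, the competing matrix must be an actual network matrix.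
For the parametrization `κ z⁻¹`, the good parameters accumulate at `0`, so some `G` is a small
polynomial matrix in `w = z⁻¹`; a nontrivial relation can be scaled to be a small polynomial vector
in `w` too. Adding it to the column of `i` keeps `1 - G` diagonally dominant for `|w| ≤ 1`, hence
well-posed, and leaves the measured data unchanged (`coeff_eq_zero_of_edgesIdentifiable`).
-/

/-! ### Disjoint path families and permutations -/

/-- A permutation `τ` of `V ⊕ ι` that sends every `inr l` into `A`, leaves `V` only from nodes of
`C`, and otherwise fixes nodes or moves them along edges, contains `ι`-many disjoint paths: the
path belonging to `l` is the part of the `τ`-orbit of `inr l` up to the next return to `ι`. -/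
theorem card_le_maxDisjointPaths_of_perm {V ι : Type*} [Fintype V] [Fintype ι] {Γ : Digraph V}
    {A C : Finset V} (τ : Equiv.Perm (V ⊕ ι))
    (hV : ∀ v w, τ (Sum.inl v) = Sum.inl w → w = v ∨ Γ.Adj v w)
    (hA : ∀ l, ∃ w ∈ A, τ (Sum.inr l) = Sum.inl w)
    (hC : ∀ v l, τ (Sum.inl v) = Sum.inr l → v ∈ C) :
    Fintype.card ι ≤ maxDisjointPaths Γ A C := by
  classical
  have step : ∀ x k, (τ ^ (k + 1)) x = τ ((τ ^ k) x) := fun x k => by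
    rw [pow_succ', Equiv.Perm.mul_apply]
  -- the orbit of `inr l` returns to `ι` at some positive time
  have hret : ∀ l, ∃ n, ∃ l', (τ ^ (n + 1)) (Sum.inr l) = Sum.inr l' := fun l =>
    ⟨orderOf τ - 1, l, by
      rw [Nat.sub_add_cancel (orderOf_pos τ), pow_orderOf_eq_one, Equiv.Perm.one_apply]⟩
  choose a haA ha using hA
  let n : ι → ℕ := fun l => Nat.find (hret l)
  have hn : ∀ l, ∃ l', (τ ^ (n l + 1)) (Sum.inr l) = Sum.inr l' := fun l => Nat.find_spec (hret l)
  have hmin : ∀ l k, k < n l → ∀ l', (τ ^ (k + 1)) (Sum.inr l) ≠ Sum.inr l' :=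
    fun l k hk l' h => Nat.find_min (hret l) hk ⟨l', h⟩
  have hpos : ∀ l, 0 < n l := fun l => by
    rw [Nat.pos_iff_ne_zero]
    intro h0
    obtain ⟨l', hl'⟩ := hn l
    rw [h0, zero_add, pow_one, ha] at hl'
    cases hl'
  let f : ι → ℕ → V := fun l k => Sum.elim id (fun _ => a l) ((τ ^ (k + 1)) (Sum.inr l))
  have hf : ∀ l k, k < n l → (τ ^ (k + 1)) (Sum.inr l) = Sum.inl (f l k) := fun l k hk => by
    rcases h : (τ ^ (k + 1)) (Sum.inr l) with v | l'
    · simp [f, h]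
    · exact absurd h (hmin l k hk l')
  -- if two orbits meet at different times, the later one has returned to `ι` before
  have hback : ∀ l l' p q, p < q → q < n l' → f l p ≠ f l' q ∨ n l ≤ p := by
    intro l l' p q hpq hq
    by_contra! h
    have h1 : (τ ^ (p + 1)) (Sum.inr l) = (τ ^ (p + 1)) ((τ ^ (q - p)) (Sum.inr l')) := by
      rw [hf l p h.2, h.1, ← hf l' q hq, ← Equiv.Perm.mul_apply, ← pow_add]
      congr 2
      omega
    have h2 := (τ ^ (p + 1)).injective h1
    refine hmin l' (q - p - 1) (by omega) l ?_
    rw [h2]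
    congr 2
    omega
  have hinj : ∀ l l' p q, p < n l → q < n l' → f l p = f l' q → l = l' ∧ p = q := by
    intro l l' p q hp hq h
    rcases lt_trichotomy p q with hpq | rfl | hpq
    · rcases hback l l' p q hpq hq with h' | h'
      · exact absurd h h'
      · omega
    · have h1 : (τ ^ (p + 1)) (Sum.inr l) = (τ ^ (p + 1)) (Sum.inr l') := by
        rw [hf l p hp, h, ← hf l' p hq]
      exact ⟨Sum.inr_injective ((τ ^ (p + 1)).injective h1), rfl⟩
    · rcases hback l' l q p hpq hp with h' | h'
      · exact absurd h.symm h'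
      · omega
  let path : ι → List V := fun l => (List.range (n l)).map (f l)
  have hmem : ∀ l v, v ∈ path l ↔ ∃ p < n l, f l p = v := fun l v => by simp [path]
  have hdisj : ∀ l l', l ≠ l' → List.Disjoint (path l) (path l') := by
    intro l l' hll v hv hv'
    obtain ⟨p, hp, rfl⟩ := (hmem _ _).1 hv
    obtain ⟨q, hq, h⟩ := (hmem _ _).1 hv'
    exact hll (hinj l l' p q hp hq h.symm).1
  have hpinj : Function.Injective path := by
    intro l l' h
    by_contra hll
    have h0 : f l 0 ∈ path l := (hmem _ _).2 ⟨0, hpos l, rfl⟩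
    exact hdisj l l' hll h0 (h ▸ h0)
  refine (isGreatest_maxDisjointPaths Γ A C).2 ⟨Finset.univ.image path, ⟨?_, ?_⟩, ?_⟩
  · intro L hL
    obtain ⟨l, -, rfl⟩ := Finset.mem_image.1 hL
    refine ⟨?_, ?_, ⟨f l 0, ?_, ?_⟩, ⟨f l (n l - 1), ?_, ?_⟩⟩
    · rw [List.isChain_iff_getElem]
      intro k hk
      simp only [path, List.length_map, List.length_range] at hk
      simp only [path, List.getElem_map, List.getElem_range]
      have h1 := step (Sum.inr l) (k + 1)
      rw [hf l k (by omega), hf l (k + 1) (by omega)] at h1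
      rcases hV _ _ h1.symm with h2 | h2
      · have := (hinj l l _ _ hk (by omega) h2).2
        omega
      · exact h2
    · refine List.Nodup.map_on ?_ List.nodup_range
      intro p hp q hq h
      exact (hinj l l p q (List.mem_range.1 hp) (List.mem_range.1 hq) h).2
    · simp [path, List.head?_range, (hpos l).ne']
    · have h1 := hf l 0 (hpos l)
      rw [zero_add, pow_one, ha] at h1
      rw [← Sum.inl_injective h1]
      exact haA l
    · simp [path, List.getLast?_range, (hpos l).ne']
    · obtain ⟨l', hl'⟩ := hn l
      refine hC _ l' ?_
      rw [← hf l (n l - 1) (by have := hpos l; omega), Nat.sub_add_cancel (hpos l), ← step, hl']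
  · intro L hL L' hL' hne
    simp only [Finset.coe_image, Finset.coe_univ, Set.image_univ, Set.mem_range] at hL hL'
    obtain ⟨l, rfl⟩ := hL
    obtain ⟨l', rfl⟩ := hL'
    exact hdisj l l' fun h => hne (h ▸ rfl)
  · rw [Finset.card_image_of_injective _ hpinj, Finset.card_univ]

/-! ### Bordered matrices -/

section Bordered

variable {V ι R : Type*} [Fintype V] [DecidableEq V] [Fintype ι] [DecidableEq ι] [CommRing R]

/-- The matrix `M` bordered by the unit columns `e_{a l}` and the unit rows `e_{c l}ᵀ`. For
invertible `M` its determinant vanishes together with the minor of `M⁻¹` with rows `c` and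
columns `a`. -/
def borderedMatrix (M : Matrix V V R) (a c : ι → V) : Matrix (V ⊕ ι) (V ⊕ ι) R :=
  Matrix.fromBlocks M (Matrix.of fun v l => if v = a l then 1 else 0)
    (Matrix.of fun l v => if v = c l then 1 else 0) 0

theorem det_borderedMatrix {M : Matrix V V R} (hM : IsUnit M) (a c : ι → V) :
    (borderedMatrix M a c).det = M.det * (-(M⁻¹.submatrix c a)).det := by
  let _ : Invertible M := hM.invertible
  rw [borderedMatrix, Matrix.det_fromBlocks₁₁, zero_sub, Matrix.invOf_eq_nonsing_inv]
  congr 3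
  ext l l'
  simp [Matrix.mul_apply]

theorem det_borderedMatrix_ne_zero_iff {K : Type*} [Field K] {M : Matrix V V K} (hM : IsUnit M)
    (a c : ι → V) : (borderedMatrix M a c).det ≠ 0 ↔ (M⁻¹.submatrix c a).det ≠ 0 := by
  have h : M.det ≠ 0 := ((Matrix.isUnit_iff_isUnit_det M).1 hM).ne_zero
  rw [det_borderedMatrix hM, Matrix.det_neg]
  simp [h]

/-- By the Leibniz formula, a nonvanishing minor of `(1 - G)⁻¹` forces as many disjoint paths as
its size. -/
theorem card_le_maxDisjointPaths_of_det_ne_zero {Γ : Digraph V} {G : Matrix V V R}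
    (hG : ∀ j k, ¬ Γ.Adj j k → G k j = 0) {a c : ι → V} {A C : Finset V} (ha : ∀ l, a l ∈ A)
    (hc : ∀ l, c l ∈ C) (h : (borderedMatrix (1 - G) a c).det ≠ 0) :
    Fintype.card ι ≤ maxDisjointPaths Γ A C := by
  rw [Matrix.det_apply'] at h
  obtain ⟨τ, -, hτ⟩ := Finset.exists_ne_zero_of_sum_ne_zero h
  have hτ' : ∀ x, borderedMatrix (1 - G) a c (τ x) x ≠ 0 := fun x hx =>
    right_ne_zero_of_mul hτ (Finset.prod_eq_zero (Finset.mem_univ x) hx)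
  refine card_le_maxDisjointPaths_of_perm τ ?_ ?_ ?_
  · intro v w hw
    have := hτ' (Sum.inl v)
    rw [hw] at this
    by_contra! hvw
    exact this (by simp [borderedMatrix, Matrix.one_apply_ne hvw.1, hG v w hvw.2])
  · intro l
    have := hτ' (Sum.inr l)
    rcases hw : τ (Sum.inr l) with w | l'
    · rw [hw] at this
      refine ⟨w, ?_, rfl⟩
      have hwa : w = a l := by
        by_contra hne
        exact this (by simp [borderedMatrix, hne])
      exact hwa ▸ ha l
    · rw [hw] at this
      exact absurd (by simp [borderedMatrix]) this
  · intro v l hl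
    have := hτ' (Sum.inl v)
    rw [hl] at this
    have hvc : v = c l := by
      by_contra hne
      exact this (by simp [borderedMatrix, hne])
    exact hvc ▸ hc l

end Bordered

theorem map_borderedMatrix {V ι R S : Type*} [DecidableEq V] [CommRing R] [CommRing S]
    (φ : R →+* S) (M : Matrix V V R) (a c : ι → V) :
    (borderedMatrix M a c).map φ = borderedMatrix (M.map φ) a c := by
  ext x y
  rcases x with x | x <;> rcases y with y | y <;> simp [borderedMatrix, apply_ite φ]

/-! ### Matrices supported on a disjoint path family -/

/-- `u` and `v` are consecutive vertices of a path in `S`. -/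
def IsStep {V : Type*} (S : Finset (List V)) (u v : V) : Prop :=
  ∃ L ∈ S, ∃ k, ∃ h : k + 1 < L.length, L[k] = u ∧ L[k + 1] = v

/-- If `G` is nonzero exactly on the steps of a disjoint path family, then the corresponding minor
of `(1 - G)⁻¹` does not vanish: a kernel vector of the bordered matrix vanishes at the path ends,
hence, going backwards, along the paths, and then everywhere. The factor `d` allows for cleared
denominators. -/
theorem det_borderedMatrix_ne_zero_of_isDisjointPathFamily {V K : Type*} [Fintype V]
    [DecidableEq V] [Field K] {Γ : Digraph V} {A C : Finset V} {S : Finset (List V)}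
    (hS : IsDisjointPathFamily Γ A C S) {G : Matrix V V K}
    (hG : ∀ u v, G v u ≠ 0 ↔ IsStep S u v) {d : K} (hd : d ≠ 0) {a c : {L // L ∈ S} → V}
    (ha : ∀ L, a L ∈ L.1.head?) (hc : ∀ L, c L ∈ L.1.getLast?) [DecidableEq {L // L ∈ S}] :
    (borderedMatrix (d • (1 - G)) a c).det ≠ 0 := by
  intro hdet
  obtain ⟨z, hz0, hz⟩ := Matrix.exists_mulVec_eq_zero_iff.2 hdet
  apply hz0
  have uniq : ∀ L ∈ S, ∀ L' ∈ S, ∀ k (hk : k < L.length) k' (hk' : k' < L'.length),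
      L[k] = L'[k'] → L = L' ∧ k = k' := by
    intro L hL L' hL' k hk k' hk' h
    have hLL : L = L' := by
      by_contra hne
      exact hS.2 hL hL' hne (List.getElem_mem hk) (h ▸ List.getElem_mem hk')
    subst hLL
    exact ⟨rfl, ((hS.1 L hL).nodup.getElem_inj_iff).1 h⟩
  have hpos : ∀ L ∈ S, 0 < L.length := by
    intro L hL
    obtain ⟨b, hb, -⟩ := (hS.1 L hL).start_mem
    exact List.length_pos_of_mem (List.mem_of_mem_head? hb)
  have ha' : ∀ L : {L // L ∈ S}, a L = L.1[0]'(hpos _ L.2) := by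
    intro L
    have := ha L
    rw [List.head?_eq_getElem?, Option.mem_def, List.getElem?_eq_some_iff] at this
    exact this.2.symm
  have hc' : ∀ L : {L // L ∈ S},
      c L = L.1[L.1.length - 1]'(by have := hpos _ L.2; omega) := by
    intro L
    have := hc L
    rw [List.getLast?_eq_getElem?, Option.mem_def, List.getElem?_eq_some_iff] at this
    obtain ⟨_, h⟩ := this
    exact h.symm
  have hrow : ∀ v, d * (z (Sum.inl v) - ∑ u, G v u * z (Sum.inl u)) +
      ∑ L, (if v = a L then z (Sum.inr L) else 0) = 0 := by
    intro v
    have := congrFun hz (Sum.inl v)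
    simpa [borderedMatrix, Matrix.mulVec, dotProduct, sub_mul, Matrix.one_apply, mul_sub,
      Finset.mul_sum, mul_assoc, Finset.sum_sub_distrib] using this
  have hend : ∀ L, z (Sum.inl (c L)) = 0 := by
    intro L
    have := congrFun hz (Sum.inr L)
    simpa [borderedMatrix, Matrix.mulVec, dotProduct] using this
  -- only the path predecessor contributes to the row of a vertex that a step enters
  have hstep : ∀ L ∈ S, ∀ k (hk : k + 1 < L.length), z (Sum.inl L[k + 1]) = 0 →
      z (Sum.inl L[k]) = 0 := by
    intro L hL k hk h0
    have h1 := hrow L[k + 1]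
    rw [Finset.sum_eq_single L[k]] at h1
    · rw [Finset.sum_eq_zero, h0] at h1
      · have hne := (hG L[k] L[k + 1]).2 ⟨L, hL, k, hk, rfl, rfl⟩
        simpa [hd, hne] using h1
      · intro L' _
        rw [if_neg]
        intro h
        rw [ha' L'] at h
        have := (uniq L hL L'.1 L'.2 _ hk _ (hpos _ L'.2) h).2
        omega
    · intro u _ hu
      have : G L[k + 1] u = 0 := by
        by_contra hne
        obtain ⟨L', hL', k', hk', rfl, h2⟩ := (hG _ _).1 hne
        obtain ⟨rfl, h3⟩ := uniq L' hL' L hL _ hk' _ hk h2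
        obtain rfl : k' = k := by omega
        exact hu rfl
      rw [this, zero_mul]
    · simp
  have hpath : ∀ L ∈ S, ∀ t, ∀ ht : t < L.length, z (Sum.inl (L[L.length - 1 - t])) = 0 := by
    intro L hL t
    induction t with
    | zero =>
      intro ht
      have := hend ⟨L, hL⟩
      rw [hc'] at this
      exact this
    | succ t ih =>
      intro ht
      refine hstep L hL (L.length - 1 - (t + 1)) (by omega) ?_
      have := ih (by omega)
      convert this using 4
      omega
  have hon : ∀ L ∈ S, ∀ k (hk : k < L.length), z (Sum.inl L[k]) = 0 := by
    intro L hL k hk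
    have := hpath L hL (L.length - 1 - k) (by omega)
    convert this using 4
    omega
  have hsum : ∀ v, ∑ u, G v u * z (Sum.inl u) = 0 := by
    intro v
    refine Finset.sum_eq_zero fun u _ => ?_
    by_cases h : G v u = 0
    · rw [h, zero_mul]
    · obtain ⟨L, hL, k, hk, rfl, -⟩ := (hG _ _).1 h
      rw [hon L hL k (by omega), mul_zero]
  have hr : ∀ L, z (Sum.inr L) = 0 := by
    intro L
    have h1 := hrow (a L)
    rw [hsum, sub_zero, Finset.sum_eq_single L, if_pos rfl] at h1
    · have h2 : z (Sum.inl (a L)) = 0 := by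
        rw [ha']
        exact hon _ L.2 _ _
      simpa [h2] using h1
    · intro L' _ hne
      rw [if_neg]
      intro h
      rw [ha', ha'] at h
      exact hne (Subtype.ext (uniq _ L.2 _ L'.2 _ _ _ _ h).1.symm)
    · simp
  ext x
  rcases x with v | L
  · have h1 := hrow v
    simpa [hsum, hr, hd] using h1
  · exact hr L

/-! ### Linear algebra of column spans -/

section Spans

variable {K E V : Type*} [Field K] [AddCommGroup E] [Module K E]

open Module

theorem mem_span_image_finset_iff [DecidableEq V] (t : V → E) (s : Finset V) (x : E) :
    x ∈ Submodule.span K (t '' s) ↔ ∃ c : V → K, ∑ v ∈ s, c v • t v = x := by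
  rw [Submodule.mem_span_image_finset_iff_exists_fun]
  constructor
  · rintro ⟨c, rfl⟩
    refine ⟨fun v => if h : v ∈ s then c ⟨v, h⟩ else 0, ?_⟩
    rw [← Finset.sum_coe_sort]
    simp
  · rintro ⟨c, rfl⟩
    exact ⟨fun v => c v, Finset.sum_coe_sort s fun v => c v • t v⟩

variable [FiniteDimensional K E]

/-- If a linear relation among the vectors `t v`, `v ∈ N ∪ B`, always has zero coefficients on
`N`, then `N` contributes `#N` dimensions to the span of the vectors in `N ∪ B`. -/
theorem finrank_span_union_of_coeff_eq_zero [DecidableEq V] (t : V → E) (N B : Finset V)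
    (h : ∀ y z : V → K, ∑ v ∈ N, y v • t v + ∑ v ∈ B, z v • t v = 0 → ∀ v ∈ N, y v = 0) :
    finrank K (Submodule.span K (t '' N)) = N.card ∧
      finrank K (Submodule.span K (t '' (N ∪ B : Finset V))) =
        N.card + finrank K (Submodule.span K (t '' B)) := by
  have hli : LinearIndepOn K t (N : Set V) := by
    rw [linearIndepOn_finset_iff]
    intro g hg
    exact h g 0 (by simpa using hg)
  have hN : finrank K (Submodule.span K (t '' N)) = N.card := by
    rw [Set.image_eq_range]
    exact (finrank_span_eq_card hli).trans (by simp)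
  refine ⟨hN, ?_⟩
  have hinf : Submodule.span K (t '' N) ⊓ Submodule.span K (t '' B) = ⊥ := by
    rw [eq_bot_iff]
    rintro x ⟨hxN, hxB⟩
    obtain ⟨y, rfl⟩ := (mem_span_image_finset_iff _ _ _).1 hxN
    obtain ⟨z, hz⟩ := (mem_span_image_finset_iff _ _ _).1 hxB
    have := h y (-z) (by simp [hz])
    exact Finset.sum_eq_zero fun v hv => by rw [this v hv, zero_smul]
  have := Submodule.finrank_sup_add_finrank_inf_eq (Submodule.span K (t '' N))
    (Submodule.span K (t '' B))
  rw [hinf, finrank_bot, add_zero, hN, ← Submodule.span_union, ← Set.image_union,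
    ← Finset.coe_union] at this
  exact this

/-- Converse of `finrank_span_union_of_coeff_eq_zero`: if `N` contributes (at least) `#N`
dimensions, then every relation has zero coefficients on `N`. -/
theorem coeff_eq_zero_of_finrank_span_union [DecidableEq V] (t : V → E) (N B : Finset V)
    (h : N.card + finrank K (Submodule.span K (t '' B)) ≤
      finrank K (Submodule.span K (t '' (N ∪ B : Finset V)))) (y z : V → K)
    (hyz : ∑ v ∈ N, y v • t v + ∑ v ∈ B, z v • t v = 0) : ∀ v ∈ N, y v = 0 := by
  have hN : finrank K (Submodule.span K (t '' N)) ≤ N.card := by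
    classical
    rw [← Finset.coe_image]
    exact (finrank_span_finset_le_card _).trans Finset.card_image_le
  have hsup := Submodule.finrank_sup_add_finrank_inf_eq (Submodule.span K (t '' N))
    (Submodule.span K (t '' B))
  rw [← Submodule.span_union, ← Set.image_union, ← Finset.coe_union] at hsup
  have hinf : Submodule.span K (t '' N) ⊓ Submodule.span K (t '' B) = ⊥ :=
    Submodule.finrank_eq_zero.1 (by omega)
  have hli : LinearIndepOn K t (N : Set V) := by
    refine linearIndependent_iff_card_eq_finrank_span.2 ?_
    rw [Set.finrank, ← Set.image_eq_range]
    simp only [Finset.coe_sort_coe, Fintype.card_coe]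
    omega
  have hsum : ∑ v ∈ N, y v • t v = 0 := by
    rw [← Submodule.mem_bot K, ← hinf]
    refine ⟨(mem_span_image_finset_iff _ _ _).2 ⟨y, rfl⟩,
      (mem_span_image_finset_iff _ _ _).2 ⟨-z, ?_⟩⟩
    simpa [eq_comm] using eq_neg_of_add_eq_zero_left hyz
  exact linearIndepOn_finset_iff.1 hli y hsum

/-- Linearly independent column vectors have a nonvanishing maximal minor. -/
theorem exists_det_ne_zero_of_linearIndependent {m k : Type*} [Fintype m] [Fintype k]
    [DecidableEq k] {f : k → m → K} (hf : LinearIndependent K f) :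
    ∃ r : k → m, (Matrix.of fun l l' => f l' (r l)).det ≠ 0 := by
  have hrank := LinearIndependent.rank_matrix (M := Matrix.of f) hf
  rw [Matrix.rank_eq_finrank_span_cols] at hrank
  obtain ⟨g, hg, -, hgli⟩ :=
    Submodule.exists_fun_fin_finrank_span_eq K (Set.range (Matrix.of f).col)
  choose r hr using hg
  let e : k ≃ Fin (finrank K (Submodule.span K (Set.range (Matrix.of f).col))) :=
    Fintype.equivOfCardEq (by simp [hrank])
  refine ⟨r ∘ e, ?_⟩
  have hli : LinearIndependent K (Matrix.of fun l l' => f l' ((r ∘ e) l)).row := by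
    have := hgli.comp e e.injective
    have heq : (Matrix.of fun l l' => f l' ((r ∘ e) l)).row = g ∘ e := by
      ext l l'
      rw [Function.comp_apply, ← hr]
      rfl
    rwa [heq]
  exact ((Matrix.isUnit_iff_isUnit_det _).1
    (Matrix.linearIndependent_rows_iff_isUnit.1 hli)).ne_zero

end Spans

/-! ### Zero sets of polynomials are null sets -/

/-- By Fubini, freezing all variables but one. -/
theorem ae_eval_ne_zero_fin {n : ℕ} {F : MvPolynomial (Fin n) ℝ} (hF : F ≠ 0) :
    ∀ᵐ P : Fin n → ℝ, MvPolynomial.eval P F ≠ 0 := by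
  induction n with
  | zero =>
    refine Filter.Eventually.of_forall fun P h => hF ?_
    exact MvPolynomial.funext fun Q => by rw [Subsingleton.elim Q P, h, map_zero]
  | succ n ih =>
    have hF' : MvPolynomial.finSuccEquiv ℝ n F ≠ 0 := by simpa using hF
    obtain ⟨d, hd⟩ : ∃ d, (MvPolynomial.finSuccEquiv ℝ n F).coeff d ≠ 0 := by
      by_contra! h
      exact hF' (Polynomial.ext (by simpa using h))
    have hmp := volume_preserving_piFinSuccAbove (fun _ : Fin (n + 1) => ℝ) 0
    have hcont : Continuous fun q : ℝ × (Fin n → ℝ) =>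
        MvPolynomial.eval (Fin.cons q.1 q.2 : Fin (n + 1) → ℝ) F :=
      (MvPolynomial.continuous_eval F).comp (by fun_prop)
    have hmeas : MeasurableSet {q : ℝ × (Fin n → ℝ) |
        MvPolynomial.eval (Fin.cons q.1 q.2 : Fin (n + 1) → ℝ) F ≠ 0} :=
      (isOpen_ne_fun hcont continuous_const).measurableSet
    have hprod : ∀ᵐ q : ℝ × (Fin n → ℝ),
        MvPolynomial.eval (Fin.cons q.1 q.2 : Fin (n + 1) → ℝ) F ≠ 0 := by
      rw [Measure.volume_eq_prod, Measure.ae_prod_iff_ae_ae hmeas,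
        Measure.ae_ae_comm (p := fun x s =>
          MvPolynomial.eval (Fin.cons x s : Fin (n + 1) → ℝ) F ≠ 0) hmeas]
      filter_upwards [ih hd] with s hs
      -- for almost all values of the other variables a nonzero polynomial in one variable is left
      have hp : Polynomial.map (MvPolynomial.eval s) (MvPolynomial.finSuccEquiv ℝ n F) ≠ 0 :=
        fun h => hs (by simpa using congrArg (fun p => Polynomial.coeff p d) h)
      have hfin := Polynomial.finite_setOfPred_isRoot hp
      filter_upwards [hfin.measure_zero volume |> measure_eq_zero_iff_ae_notMem.1] with x hx
      rw [MvPolynomial.eval_eq_eval_mv_eval']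
      exact hx
    filter_upwards [hmp.quasiMeasurePreserving.ae hprod] with P hP
    convert hP
    exact (Fin.cons_self_tail P).symm

theorem ae_eval_ne_zero {ι : Type*} [Fintype ι] {F : MvPolynomial ι ℝ} (hF : F ≠ 0) :
    ∀ᵐ P : ι → ℝ, MvPolynomial.eval P F ≠ 0 := by
  let e := Fintype.equivFin ι
  have hF' : MvPolynomial.rename e F ≠ 0 := by
    rwa [Ne, MvPolynomial.rename_eq_zero_iff_of_injective _ e.injective]
  have hmp := volume_measurePreserving_piCongrLeft (fun _ : Fin (Fintype.card ι) => ℝ) e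
  filter_upwards [hmp.quasiMeasurePreserving.ae (ae_eval_ne_zero_fin hF')] with P hP
  rw [MvPolynomial.eval_rename] at hP
  convert hP
  ext i
  exact (Equiv.piCongrLeft_apply_apply (fun _ => ℝ) e P i).symm

/-! ### The rank of the measured columns -/

section ColRank

variable {V K : Type*} [DecidableEq V] [Field K] {n : ℕ}

/-- The rank of the submatrix of `T` with rows `sel r` and columns in `A`, as the dimension of the
span of its columns. -/
noncomputable def measuredRank (sel : Fin n → V) (T : Matrix V V K) (A : Finset V) : ℕ :=
  Module.finrank K (Submodule.span K ((fun v r => T (sel r) v) '' (A : Set V)))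

/-- This bound holds for every consistent `G`, not only generically. -/
theorem measuredRank_le_maxDisjointPaths [Fintype V] {Γ : Digraph V} {G : Matrix V V K}
    (hG : ∀ j k, ¬ Γ.Adj j k → G k j = 0) (hunit : IsUnit (1 - G)) (sel : Fin n → V)
    (A : Finset V) :
    measuredRank sel (1 - G)⁻¹ A ≤ maxDisjointPaths Γ A (Finset.univ.image sel) := by
  obtain ⟨f, hf, -, hli⟩ := Submodule.exists_fun_fin_finrank_span_eq K
    ((fun v r => (1 - G)⁻¹ (sel r) v) '' (A : Set V))
  choose a haA haf using hf
  obtain ⟨r, hr⟩ := exists_det_ne_zero_of_linearIndependent hli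
  have h := card_le_maxDisjointPaths_of_det_ne_zero (a := a) (c := fun l => sel (r l))
    (C := Finset.univ.image sel) hG haA
    (fun l => Finset.mem_image_of_mem _ (Finset.mem_univ _)) <| by
      rw [det_borderedMatrix_ne_zero_iff hunit]
      convert hr using 3
      ext l l'
      simp [← haf]
  simpa [measuredRank] using h

theorem card_le_measuredRank {ι : Type*} [Fintype ι] [DecidableEq ι] {T : Matrix V V K}
    {sel : Fin n → V} {A : Finset V} {a c : ι → V} (ha : ∀ l, a l ∈ A)
    (hc : ∀ l, c l ∈ Finset.univ.image sel) (h : (T.submatrix c a).det ≠ 0) :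
    Fintype.card ι ≤ measuredRank sel T A := by
  have hc' : ∀ l, ∃ r, sel r = c l := fun l => by simpa using hc l
  choose r hr using hc'
  have hli : LinearIndependent K fun l => (fun s => T (sel s) (a l) : Fin n → K) := by
    refine LinearIndependent.of_comp (LinearMap.funLeft K K r) ?_
    have := Matrix.linearIndependent_cols_iff_isUnit.2
      ((Matrix.isUnit_iff_isUnit_det _).2 (isUnit_iff_ne_zero.2 h))
    convert this using 1
    ext l l'
    simp [LinearMap.funLeft, hr]
  rw [← finrank_span_eq_card hli, measuredRank]
  refine Submodule.finrank_mono (Submodule.span_mono ?_)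
  rintro _ ⟨l, rfl⟩
  exact ⟨a l, ha l, rfl⟩

end ColRank

/-! ### Rational functions depending polynomially on parameters -/

/-- Substitute real parameters into a polynomial with coefficients in `ℝ[z]`, giving a rational
function of `z`. -/
noncomputable def evalParam {ι : Type*} (P : ι → ℝ) : MvPolynomial ι ℝ[X] →+* RatFunc ℝ :=
  (algebraMap ℝ[X] (RatFunc ℝ)).comp (MvPolynomial.eval fun i => C (P i))

/-- A rational function that depends polynomially on the parameters and is nonzero for one
parameter vector is nonzero for almost all of them. -/
theorem ae_evalParam_ne_zero {ι : Type*} [Fintype ι] {F : MvPolynomial ι ℝ[X]} {P₀ : ι → ℝ}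
    (h : evalParam P₀ F ≠ 0) : ∀ᵐ P : ι → ℝ, evalParam P F ≠ 0 := by
  have h0 : MvPolynomial.eval (fun i => C (P₀ i)) F ≠ 0 := fun h' => h (by simp [evalParam, h'])
  obtain ⟨z, hz⟩ : ∃ z : ℝ, (MvPolynomial.eval (fun i => C (P₀ i)) F).eval z ≠ 0 := by
    by_contra! h'
    exact h0 (Polynomial.funext (by simpa using h'))
  -- specialise `z` to a real number at which the value at `P₀` survives
  have hcomm : ∀ P : ι → ℝ, MvPolynomial.eval P (MvPolynomial.map (evalRingHom z) F) =
      (MvPolynomial.eval (fun i => C (P i)) F).eval z := by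
    intro P
    have heq : (MvPolynomial.eval P).comp (MvPolynomial.map (evalRingHom z)) =
        (evalRingHom z).comp (MvPolynomial.eval fun i => C (P i)) := by
      apply MvPolynomial.ringHom_ext <;> simp
    exact congrArg (fun φ : MvPolynomial ι ℝ[X] →+* ℝ => φ F) heq
  have hF : MvPolynomial.map (evalRingHom z) F ≠ 0 := by
    intro h'
    apply hz
    rw [← hcomm, h', map_zero]
  filter_upwards [ae_eval_ne_zero hF] with P hP h'
  apply hP
  rw [hcomm]
  have : MvPolynomial.eval (fun i => C (P i)) F = 0 := by simpa [evalParam] using h'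
  rw [this, eval_zero]

theorem ae_det_map_evalParam_ne_zero {ι n : Type*} [Fintype ι] [Fintype n] [DecidableEq n]
    {M : Matrix n n (MvPolynomial ι ℝ[X])} {P₀ : ι → ℝ} (h : (M.map (evalParam P₀)).det ≠ 0) :
    ∀ᵐ P : ι → ℝ, (M.map (evalParam P)).det ≠ 0 := by
  have key : ∀ P, (M.map (evalParam P)).det = evalParam P M.det := fun P =>
    ((evalParam P).map_det M).symm
  simp only [key] at h ⊢
  exact ae_evalParam_ne_zero h

namespace TFParametrization

variable {V : Type*} {Γ : Digraph V} (π : TFParametrization Γ)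

/-- The numerator of the transfer function of an edge, as a polynomial in the parameters. -/
noncomputable def numPoly (e : GraphEdge Γ) : MvPolynomial π.Index ℝ[X] :=
  MvPolynomial.X ⟨e, Sum.inl ()⟩ * (MvPolynomial.C (X ^ π.n e) +
    ∑ m : Fin (π.n e), MvPolynomial.X ⟨e, Sum.inr (Sum.inl m)⟩ * MvPolynomial.C (X ^ (m : ℕ)))

/-- The denominator of the transfer function of an edge, as a polynomial in the parameters. -/
noncomputable def denPoly (e : GraphEdge Γ) : MvPolynomial π.Index ℝ[X] :=
  MvPolynomial.C (X ^ π.p e) * (MvPolynomial.C (X ^ π.n e) +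
    ∑ m : Fin (π.n e), MvPolynomial.X ⟨e, Sum.inr (Sum.inr m)⟩ * MvPolynomial.C (X ^ (m : ℕ)))

theorem monicPoly_ne_zero {n : ℕ} (f : Fin n → ℝ) :
    algebraMap ℝ[X] (RatFunc ℝ) (X ^ n + ∑ m, C (f m) * X ^ (m : ℕ)) ≠ 0 :=
  RatFunc.algebraMap_ne_zero (monic_X_pow_add (degree_sum_fin_lt f)).ne_zero

theorem evalParam_denPoly_ne_zero (P : π.Index → ℝ) (e : GraphEdge Γ) :
    evalParam P (π.denPoly e) ≠ 0 := by
  have h := monicPoly_ne_zero (π.alpha P e)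
  have hX : (RatFunc.X : RatFunc ℝ) ≠ 0 := RatFunc.X_ne_zero
  simpa [evalParam, denPoly, alpha, hX] using h

theorem entry_eq_div (P : π.Index → ℝ) (e : GraphEdge Γ) :
    π.entry P e = evalParam P (π.numPoly e) / evalParam P (π.denPoly e) := by
  simp [entry, evalParam, denPoly, numPoly, alpha, beta, kappa, div_eq_mul_inv]
  ring

theorem entry_ne_zero_iff (P : π.Index → ℝ) (e : GraphEdge Γ) :
    π.entry P e ≠ 0 ↔ π.kappa P e ≠ 0 := by
  have hX : (RatFunc.X : RatFunc ℝ) ≠ 0 := RatFunc.X_ne_zero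
  rw [entry]
  simp only [ne_eq, mul_eq_zero, inv_eq_zero, pow_eq_zero_iff', hX, div_eq_zero_iff,
    monicPoly_ne_zero]
  simp

theorem isConsistent_toMatrix (P : π.Index → ℝ) : IsConsistent Γ (π.toMatrix P) :=
  fun j k h => by simp [toMatrix, h]

open scoped Classical in
/-- The product of the denominators of all edges. -/
noncomputable def commonDen [Fintype V] : MvPolynomial π.Index ℝ[X] :=
  ∏ e, π.denPoly e

open scoped Classical in
/-- The matrix `1 - G(P, z)`, multiplied by the common denominator of its entries, as a matrix of
polynomials in the parameters. -/
noncomputable def clearedMatrix [Fintype V] : Matrix V V (MvPolynomial π.Index ℝ[X]) :=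
  fun k j => (if k = j then π.commonDen else 0) -
    if h : Γ.Adj j k then π.numPoly ⟨(j, k), h⟩ * ∏ e ∈ Finset.univ.erase ⟨(j, k), h⟩, π.denPoly e
    else 0

variable [Fintype V]

theorem evalParam_commonDen_ne_zero (P : π.Index → ℝ) : evalParam P π.commonDen ≠ 0 := by
  rw [commonDen, map_prod]
  exact Finset.prod_ne_zero_iff.2 fun e _ => π.evalParam_denPoly_ne_zero P e

theorem map_clearedMatrix [DecidableEq V] (P : π.Index → ℝ) :
    π.clearedMatrix.map (evalParam P) = evalParam P π.commonDen • (1 - π.toMatrix P) := by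
  classical
  have hdiag : ∀ k j : V, evalParam P (if k = j then π.commonDen else 0) =
      evalParam P π.commonDen * (1 : Matrix V V (RatFunc ℝ)) k j := by
    intro k j
    by_cases h : k = j
    · subst h
      simp
    · simp [h]
  ext k j
  simp only [clearedMatrix, Matrix.map_apply, Matrix.smul_apply, Matrix.sub_apply, smul_eq_mul,
    map_sub, mul_sub, toMatrix]
  congr 1
  · rw [← hdiag]
    congr
  · by_cases h : Γ.Adj j k
    · simp only [h, dif_pos]
      rw [entry_eq_div, commonDen, ← Finset.mul_prod_erase _ _ (Finset.mem_univ ⟨(j, k), h⟩),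
        map_mul, map_mul, mul_comm (evalParam P (π.denPoly _)), mul_assoc,
        mul_div_cancel₀ _ (π.evalParam_denPoly_ne_zero P _), mul_comm]
      congr!
    · simp [h]

theorem ae_isUnit [DecidableEq V] : ∀ᵐ P : π.Index → ℝ, IsUnit (1 - π.toMatrix P) := by
  -- at the zero parameter vector all gains vanish, so `G = 0`
  have h0 : (π.clearedMatrix.map (evalParam 0)).det ≠ 0 := by
    have hG : π.toMatrix 0 = 0 := by
      ext k j
      simp only [toMatrix, Matrix.zero_apply]
      split_ifs with h
      · by_contra hne
        exact (π.entry_ne_zero_iff 0 _).1 hne rfl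
      · rfl
    rw [map_clearedMatrix, hG, sub_zero, Matrix.det_smul, Matrix.det_one, mul_one]
    exact pow_ne_zero _ (π.evalParam_commonDen_ne_zero 0)
  filter_upwards [ae_det_map_evalParam_ne_zero h0] with P hP
  rw [map_clearedMatrix, Matrix.det_smul] at hP
  exact (Matrix.isUnit_iff_isUnit_det _).2 (isUnit_iff_ne_zero.2 (right_ne_zero_of_mul hP))

/-- For almost all parameters, the rank of the columns of `C (1 - G(P, z))⁻¹` with indices in `A`
is the maximum number of disjoint paths from `A` to the measured nodes. -/
theorem ae_measuredRank_eq [DecidableEq V] {n : ℕ} (sel : Fin n → V) (A : Finset V) :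
    ∀ᵐ P : π.Index → ℝ, measuredRank sel (1 - π.toMatrix P)⁻¹ A =
      maxDisjointPaths Γ A (Finset.univ.image sel) := by
  classical
  obtain ⟨S, hS, hcard⟩ := (isGreatest_maxDisjointPaths Γ A (Finset.univ.image sel)).1
  have hstart := fun L : {L // L ∈ S} => (hS.1 L.1 L.2).start_mem
  have hend := fun L : {L // L ∈ S} => (hS.1 L.1 L.2).end_mem
  choose a ha haA using hstart
  choose c hc hcC using hend
  have hadj : ∀ u v, IsStep S u v → Γ.Adj u v := by
    rintro u v ⟨L, hL, k, hk, rfl, rfl⟩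
    exact List.isChain_iff_getElem.1 (hS.1 L hL).chain k hk
  -- parameters at which exactly the edges used by the path family are switched on
  let P₀ : π.Index → ℝ := fun x => if IsStep S x.1.1.1 x.1.1.2 then 1 else 0
  have hP₀ : ∀ u v, π.toMatrix P₀ v u ≠ 0 ↔ IsStep S u v := by
    intro u v
    by_cases h : Γ.Adj u v
    · have := π.entry_ne_zero_iff P₀ ⟨(u, v), h⟩
      simp only [toMatrix, h, dif_pos]
      rw [this]
      simp [kappa, P₀]
    · simp only [toMatrix, h, dif_neg, not_false_iff, ne_eq, not_true, false_iff]
      exact fun h' => h (hadj _ _ h')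
  have h0 : ((borderedMatrix π.clearedMatrix a c).map (evalParam P₀)).det ≠ 0 := by
    rw [map_borderedMatrix, map_clearedMatrix]
    exact det_borderedMatrix_ne_zero_of_isDisjointPathFamily hS hP₀
      (π.evalParam_commonDen_ne_zero P₀) ha hc
  filter_upwards [ae_det_map_evalParam_ne_zero h0, π.ae_isUnit] with P hP hu
  refine le_antisymm (measuredRank_le_maxDisjointPaths (π.isConsistent_toMatrix P) hu sel A) ?_
  rw [map_borderedMatrix, map_clearedMatrix] at hP
  set T := (1 - π.toMatrix P)⁻¹ with hT
  have hd := π.evalParam_commonDen_ne_zero P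
  have hdet : IsUnit (1 - π.toMatrix P).det := (Matrix.isUnit_iff_isUnit_det _).1 hu
  have hsmul : IsUnit (evalParam P π.commonDen • (1 - π.toMatrix P)) := by
    rw [Matrix.isUnit_iff_isUnit_det, Matrix.det_smul]
    exact ((isUnit_iff_ne_zero.2 hd).pow _).mul hdet
  rw [det_borderedMatrix_ne_zero_iff hsmul,
    Matrix.inv_eq_right_inv (B := (evalParam P π.commonDen)⁻¹ • T) (by
      rw [hT, Matrix.smul_mul, Matrix.mul_smul, Matrix.mul_nonsing_inv _ hdet, smul_smul,
        mul_inv_cancel₀ hd, one_smul]),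
    show ((evalParam P π.commonDen)⁻¹ • T).submatrix c a =
      (evalParam P π.commonDen)⁻¹ • T.submatrix c a from rfl, Matrix.det_smul] at hP
  have := card_le_measuredRank haA hcC (right_ne_zero_of_mul hP)
  simpa [hcard] using this

end TFParametrization

/-! ### Polynomials in `z⁻¹` -/

/-- Substitution of `z⁻¹` for the variable, as a map from real polynomials to rational functions
of `z`. -/
noncomputable def invSubst : ℝ[X] →+* RatFunc ℝ := eval₂RingHom RatFunc.C RatFunc.X⁻¹

/-- Multiplying `g(z⁻¹)` by `z ^ n` reverses the coefficients of `g`. -/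
theorem invSubst_mul_X_pow {g : ℝ[X]} {n : ℕ} (hg : g.natDegree ≤ n) :
    invSubst g * RatFunc.X ^ n = algebraMap ℝ[X] (RatFunc ℝ) (reflect n g) := by
  have hX : (RatFunc.X : RatFunc ℝ) ≠ 0 := RatFunc.X_ne_zero
  let _ : Invertible (RatFunc.X : RatFunc ℝ) := invertibleOfNonzero hX
  have h := eval₂_reflect_mul_pow RatFunc.C (RatFunc.X : RatFunc ℝ) n (reflect n g)
    (natDegree_reflect_le.trans (by simp [hg]))
  rw [reflect_reflect] at h
  rw [invSubst, coe_eval₂RingHom]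
  refine h.trans ?_
  induction reflect n g using Polynomial.induction_on' with
  | add p q hp hq => rw [eval₂_add, map_add, hp, hq]
  | monomial k a => rw [eval₂_monomial, ← C_mul_X_pow_eq_monomial]; simp

theorem invSubst_ne_zero {f : ℝ[X]} (hf : f ≠ 0) : invSubst f ≠ 0 := by
  intro h
  have := invSubst_mul_X_pow (g := f) le_rfl
  rw [h, zero_mul, eq_comm] at this
  exact RatFunc.algebraMap_ne_zero (mt reflect_eq_zero_iff.1 hf) this

theorem isProperTF_div {p q : ℝ[X]} (hq : q ≠ 0) (h : p.natDegree ≤ q.natDegree) :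
    IsProperTF (algebraMap ℝ[X] (RatFunc ℝ) p / algebraMap ℝ[X] (RatFunc ℝ) q) := by
  by_cases hp : p = 0
  · simp [hp, IsProperTF]
  have hdeg := RatFunc.intDegree_div (RatFunc.algebraMap_ne_zero hp) (RatFunc.algebraMap_ne_zero hq)
  rw [RatFunc.intDegree_polynomial, RatFunc.intDegree_polynomial, RatFunc.intDegree] at hdeg
  rw [IsProperTF]
  omega

/-- A quotient of two polynomials in `w = z⁻¹` whose denominator has no zero in the closed unit
disc `‖w‖ ≤ 1` is proper and stable. -/
theorem isProperTF_and_isStableTF_invSubst_div {f : ℝ[X]}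
    (hf : ∀ w : ℂ, ‖w‖ ≤ 1 → aeval w f ≠ 0) (g : ℝ[X]) :
    IsProperTF (invSubst g / invSubst f) ∧ IsStableTF (invSubst g / invSubst f) := by
  set n := max g.natDegree f.natDegree
  have hX : (RatFunc.X : RatFunc ℝ) ^ n ≠ 0 := pow_ne_zero _ RatFunc.X_ne_zero
  have heq : invSubst g / invSubst f = algebraMap ℝ[X] (RatFunc ℝ) (reflect n g) /
      algebraMap ℝ[X] (RatFunc ℝ) (reflect n f) := by
    rw [← invSubst_mul_X_pow (le_max_left _ _), ← invSubst_mul_X_pow (le_max_right _ _),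
      mul_div_mul_right _ _ hX]
  have hf0 : f.coeff 0 ≠ 0 := by
    have := hf 0 (by simp)
    intro h
    apply this
    rw [aeval_def, eval₂_at_zero, h, map_zero]
  have hfne : f ≠ 0 := by
    rintro rfl
    simp at hf0
  have hrf : reflect n f ≠ 0 := mt reflect_eq_zero_iff.1 hfne
  have hdeg : n ≤ (reflect n f).natDegree := by
    refine le_natDegree_of_ne_zero ?_
    rw [coeff_reflect, revAt_le le_rfl, Nat.sub_self]
    exact hf0
  rw [heq]
  refine ⟨isProperTF_div hrf ?_, ?_⟩
  · exact (natDegree_reflect_le.trans (by simp [n])).trans hdeg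
  · intro z hz
    by_cases hz0 : z = 0
    · simp [hz0]
    have hroot : aeval z (reflect n f) = 0 := by
      obtain ⟨q, hq⟩ := RatFunc.denom_div_dvd (reflect n g) (reflect n f)
      rw [hq, map_mul, hz, zero_mul]
    let _ : Invertible z⁻¹ := invertibleOfNonzero (inv_ne_zero hz0)
    have h := eval₂_reflect_mul_pow (algebraMap ℝ ℂ) z⁻¹ n f (le_max_right _ _)
    rw [invOf_eq_inv, inv_inv, ← aeval_def, ← aeval_def, hroot, zero_mul] at h
    by_contra! hz1
    refine hf z⁻¹ ?_ h.symm
    rw [norm_inv]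
    exact inv_le_one_of_one_le₀ hz1

section Network

variable {V : Type*} [Fintype V] [DecidableEq V]

/-- A matrix of polynomials in `w = z⁻¹` whose row sums of absolute values are less than one on the
closed unit disc is a network matrix: by diagonal dominance `det (1 - H(w))` has no zero there. -/
theorem isNetworkMatrix_map_invSubst {Γ : Digraph V} {H : Matrix V V ℝ[X]}
    (hcons : ∀ j k, ¬ Γ.Adj j k → H k j = 0)
    (hsmall : ∀ w : ℂ, ‖w‖ ≤ 1 → ∀ k, ∑ j, ‖aeval w (H k j)‖ < 1) :
    IsNetworkMatrix Γ (H.map invSubst) := by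
  have hdet : ∀ w : ℂ, ‖w‖ ≤ 1 → aeval w (1 - H).det ≠ 0 := by
    intro w hw
    rw [AlgHom.map_det]
    refine det_ne_zero_of_sum_row_lt_diag fun k => ?_
    have h1 := hsmall w hw k
    rw [← Finset.add_sum_erase _ _ (Finset.mem_univ k)] at h1
    have h2 : 1 - ‖aeval w (H k k)‖ ≤ ‖1 - aeval w (H k k)‖ := by
      simpa using norm_sub_norm_le (1 : ℂ) (aeval w (H k k))
    have h3 : ∑ j ∈ Finset.univ.erase k, ‖(aeval w).mapMatrix (1 - H) k j‖ =
        ∑ j ∈ Finset.univ.erase k, ‖aeval w (H k j)‖ := by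
      refine Finset.sum_congr rfl fun j hj => ?_
      simp [Matrix.one_apply_ne (Finset.ne_of_mem_erase hj).symm]
    rw [h3]
    simp only [AlgHom.mapMatrix_apply, Matrix.map_apply, Matrix.sub_apply, Matrix.one_apply_eq,
      map_sub, map_one]
    linarith
  have hmap : 1 - H.map invSubst = invSubst.mapMatrix (1 - H) := by
    rw [map_sub, map_one, RingHom.mapMatrix_apply]
  have hdet' : (1 - H.map invSubst).det = invSubst (1 - H).det := by
    rw [hmap, RingHom.map_det]
  have hne : (1 - H).det ≠ 0 := by
    intro h
    exact hdet 0 (by simp) (by rw [h, map_zero])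
  have hinv : ∀ k j, (1 - H.map invSubst)⁻¹ k j =
      invSubst ((1 - H).adjugate k j) / invSubst (1 - H).det := by
    intro k j
    rw [Matrix.inv_def, hdet', Ring.inverse_eq_inv', Matrix.smul_apply, smul_eq_mul, hmap,
      ← RingHom.map_adjugate, RingHom.mapMatrix_apply, Matrix.map_apply, div_eq_inv_mul]
  refine ⟨?_, ?_, ?_, ?_, ?_⟩
  · intro j k h
    rw [Matrix.map_apply, hcons j k h, map_zero]
  · intro k j
    have := (isProperTF_and_isStableTF_invSubst_div (f := 1) (by simp) (H k j)).1
    simpa using this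
  · rw [Matrix.isUnit_iff_isUnit_det, hdet']
    exact isUnit_iff_ne_zero.2 (invSubst_ne_zero hne)
  · intro k j
    rw [hinv]
    exact (isProperTF_and_isStableTF_invSubst_div hdet _).1
  · intro k j
    rw [hinv]
    exact (isProperTF_and_isStableTF_invSubst_div hdet _).2

end Network

theorem exists_norm_aeval_le (g : ℝ[X]) : ∃ M > 0, ∀ w : ℂ, ‖w‖ ≤ 1 → ‖aeval w g‖ ≤ M := by
  have hcont : ContinuousOn (fun w : ℂ => aeval w g) (Metric.closedBall 0 1) :=
    (Polynomial.continuous_aeval g).continuousOn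
  obtain ⟨M, hM⟩ := (isCompact_closedBall (0 : ℂ) 1).exists_bound_of_continuousOn hcont
  exact ⟨max M 1, by positivity, fun w hw => (hM w (by simpa using hw)).trans (le_max_left _ _)⟩

/-- Finitely many rational functions become polynomials in `z⁻¹` after multiplication by a common
nonzero rational function. -/
theorem exists_mul_eq_invSubst {V : Type*} [Fintype V] (y : V → RatFunc ℝ) :
    ∃ q : RatFunc ℝ, q ≠ 0 ∧ ∃ r : V → ℝ[X], ∀ v, q * y v = invSubst (r v) := by
  classical
  let d : ℝ[X] := ∏ v, (y v).denom
  have hd : d ≠ 0 := Finset.prod_ne_zero_iff.2 fun v _ => (y v).denom_ne_zero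
  let p : V → ℝ[X] := fun v => (y v).num * ∏ u ∈ Finset.univ.erase v, (y u).denom
  have hp : ∀ v, algebraMap ℝ[X] (RatFunc ℝ) d * y v = algebraMap ℝ[X] (RatFunc ℝ) (p v) := by
    intro v
    have h1 : algebraMap ℝ[X] (RatFunc ℝ) (y v).denom ≠ 0 :=
      RatFunc.algebraMap_ne_zero (y v).denom_ne_zero
    have h2 : y v * algebraMap ℝ[X] (RatFunc ℝ) (y v).denom =
        algebraMap ℝ[X] (RatFunc ℝ) (y v).num :=
      ((div_eq_iff h1).1 (RatFunc.num_div_denom (y v))).symm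
    simp only [d, p]
    rw [← Finset.mul_prod_erase _ _ (Finset.mem_univ v), map_mul, map_mul, ← h2]
    ring
  let n := Finset.univ.sup fun v => (p v).natDegree
  have hX : (RatFunc.X : RatFunc ℝ) ^ n ≠ 0 := pow_ne_zero _ RatFunc.X_ne_zero
  refine ⟨algebraMap ℝ[X] (RatFunc ℝ) d / RatFunc.X ^ n,
    div_ne_zero (RatFunc.algebraMap_ne_zero hd) hX, fun v => reflect n (p v), fun v => ?_⟩
  have hn : (p v).natDegree ≤ n := Finset.le_sup (f := fun v => (p v).natDegree) (Finset.mem_univ v)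
  have h := invSubst_mul_X_pow (g := reflect n (p v)) (n := n)
    (natDegree_reflect_le.trans (by simp [hn]))
  rw [reflect_reflect] at h
  rw [div_mul_eq_mul_div, hp, ← h, mul_div_cancel_right₀ _ hX]

/-! ### Identifiability and ranks -/

section Identifiability

variable {V : Type*} [Fintype V] [DecidableEq V] {Γ : Digraph V} {m : ℕ} {sel : Fin m → V}
  {i : V} {N : Finset V} {G : Matrix V V (RatFunc ℝ)}

theorem selectionMatrix_mul_apply (sel : Fin m → V) (M : Matrix V V (RatFunc ℝ)) (r : Fin m)
    (v : V) : (selectionMatrix sel * M) r v = M (sel r) v := by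
  simp [selectionMatrix, Matrix.mul_apply]

/-- A network matrix `G'` with `C T = C (1 - G')⁻¹` solves `C T (1 - G') = C`. -/
theorem EdgesIdentifiableAmongSolutions.edgesIdentifiable
    (h : EdgesIdentifiableAmongSolutions Γ sel i N G) : EdgesIdentifiable Γ sel i N G := by
  intro G' hG' heq
  refine h G' hG'.consistent ?_
  rw [heq, Matrix.mul_assoc,
    Matrix.nonsing_inv_mul _ ((Matrix.isUnit_iff_isUnit_det _).1 hG'.isUnit), Matrix.mul_one]

/-- The difference of two solutions of `C T (1 - G') = C` is, in the column of the node `i`, a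
linear relation among the measured columns of the out-neighbours of `i`. -/
theorem edgesIdentifiableAmongSolutions_of_measuredRank (hN : N ⊆ outNbrs Γ i)
    (hG : IsConsistent Γ G) (hunit : IsUnit (1 - G))
    (hrank : N.card + measuredRank sel (1 - G)⁻¹ (outNbrs Γ i \ N) ≤
      measuredRank sel (1 - G)⁻¹ (outNbrs Γ i)) :
    EdgesIdentifiableAmongSolutions Γ sel i N G := by
  intro G' hG' hsol j hj
  set T := (1 - G)⁻¹ with hT
  have hTG : selectionMatrix sel * T * (1 - G) = selectionMatrix sel := by
    rw [Matrix.mul_assoc, hT,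
      Matrix.nonsing_inv_mul _ ((Matrix.isUnit_iff_isUnit_det _).1 hunit), Matrix.mul_one]
  have hdiff : selectionMatrix sel * (T * (G - G')) = 0 := by
    have h1 : G - G' = (1 - G') - (1 - G) := by abel
    rw [h1, ← Matrix.mul_assoc, Matrix.mul_sub, hsol, hTG, sub_self]
  have hout : ∀ v, v ∉ outNbrs Γ i → G v i - G' v i = 0 := by
    intro v hv
    have hv' : ¬ Γ.Adj i v := by simpa [outNbrs] using hv
    rw [hG i v hv', hG' i v hv', sub_zero]
  have hunion : N ∪ (outNbrs Γ i \ N) = outNbrs Γ i := Finset.union_sdiff_of_subset hN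
  have hrel : ∑ v ∈ N, (G v i - G' v i) • (fun r => T (sel r) v) +
      ∑ v ∈ outNbrs Γ i \ N, (G v i - G' v i) • (fun r => T (sel r) v) = 0 := by
    rw [← Finset.sum_union Finset.disjoint_sdiff, hunion,
      Finset.sum_subset (Finset.subset_univ _) fun v _ hv => by rw [hout v hv, zero_smul]]
    ext r
    have := congrFun (congrFun hdiff r) i
    rw [selectionMatrix_mul_apply, Matrix.mul_apply] at this
    simpa [mul_comm] using this
  refine sub_eq_zero.1 (coeff_eq_zero_of_finrank_span_union (K := RatFunc ℝ)
    (fun v r => T (sel r) v) N (outNbrs Γ i \ N) ?_ (fun v => G v i - G' v i)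
    (fun v => G v i - G' v i) hrel j hj)
  rw [hunion]
  exact hrank

/-- If `G` is a small polynomial matrix in `z⁻¹`, then a linear relation among the measured columns
of the out-neighbours of `i`, scaled to be a small polynomial vector in `z⁻¹`, can be added to the
column of `i` without leaving the network matrices or changing the measured data. -/
theorem coeff_eq_zero_of_edgesIdentifiable (hid : EdgesIdentifiable Γ sel i N G)
    (hunit : IsUnit (1 - G)) {H : Matrix V V ℝ[X]} (hGH : G = H.map invSubst)
    (hcons : ∀ j k, ¬ Γ.Adj j k → H k j = 0) {ε : ℝ} (hε : 0 < ε)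
    (hεV : 2 * ε * Fintype.card V < 1)
    (hsmall : ∀ w : ℂ, ‖w‖ ≤ 1 → ∀ k j, ‖aeval w (H k j)‖ ≤ ε) {x : V → RatFunc ℝ}
    (hx : ∀ v, ¬ Γ.Adj i v → x v = 0) (hrel : ∀ r, ∑ v, (1 - G)⁻¹ (sel r) v * x v = 0) :
    ∀ j ∈ N, x j = 0 := by
  intro j hj
  obtain ⟨q, hq, r, hr⟩ := exists_mul_eq_invSubst x
  choose M hM0 hM using fun v => exists_norm_aeval_le (r v)
  have hsum : 0 < ∑ v, M v := Finset.sum_pos (fun v _ => hM0 v) ⟨i, Finset.mem_univ i⟩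
  -- scaling by `c` makes every entry of `r` at most `ε` on the unit disc
  set c : ℝ := ε / ∑ v, M v
  have hc : 0 < c := div_pos hε hsum
  have hcr : ∀ w : ℂ, ‖w‖ ≤ 1 → ∀ v, ‖aeval w (C c * r v)‖ ≤ ε := by
    intro w hw v
    rw [map_mul, norm_mul, aeval_C, norm_algebraMap', Real.norm_of_nonneg hc.le]
    calc c * ‖aeval w (r v)‖ ≤ c * ∑ v, M v :=
          mul_le_mul_of_nonneg_left ((hM v w hw).trans
            (Finset.single_le_sum (fun u _ => (hM0 u).le) (Finset.mem_univ v))) hc.le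
      _ = ε := div_mul_cancel₀ _ hsum.ne'
  let D : Matrix V V ℝ[X] := Matrix.of fun k l => if l = i then C c * r k else 0
  have hDx : ∀ k, invSubst (D k i) = invSubst (C c) * q * x k := by
    intro k
    simp [D, mul_assoc, hr]
  have hnet : IsNetworkMatrix Γ ((H + D).map invSubst) := by
    refine isNetworkMatrix_map_invSubst ?_ ?_
    · intro l k hlk
      rw [Matrix.add_apply, hcons l k hlk, zero_add]
      by_cases hl : l = i
      · subst hl
        have h0 : invSubst (r k) = 0 := by rw [← hr, hx k hlk, mul_zero]
        have : r k = 0 := by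
          by_contra hne
          exact invSubst_ne_zero hne h0
        simp [D, this]
      · simp [D, hl]
    · intro w hw k
      calc ∑ l, ‖aeval w ((H + D) k l)‖ ≤ ∑ _l : V, 2 * ε := by
            refine Finset.sum_le_sum fun l _ => ?_
            rw [Matrix.add_apply, map_add, two_mul]
            refine (norm_add_le _ _).trans (add_le_add (hsmall w hw k l) ?_)
            by_cases hl : l = i
            · simpa [D, hl] using hcr w hw k
            · simp [D, hl, hε.le]
        _ < 1 := by
            rw [Finset.sum_const, Finset.card_univ, nsmul_eq_mul]
            linarith
  have hG' : (H + D).map invSubst = G + D.map invSubst := by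
    rw [hGH, Matrix.map_add _ (map_add invSubst)]
  rw [hG'] at hnet
  have hTD : selectionMatrix sel * ((1 - G)⁻¹ * D.map invSubst) = 0 := by
    ext s l
    rw [selectionMatrix_mul_apply, Matrix.mul_apply, Matrix.zero_apply]
    by_cases hl : l = i
    · subst hl
      simp only [Matrix.map_apply, hDx]
      have : ∀ v, (1 - G)⁻¹ (sel s) v * (invSubst (C c) * q * x v) =
          invSubst (C c) * q * ((1 - G)⁻¹ (sel s) v * x v) := fun v => by ring
      simp only [this]
      rw [← Finset.mul_sum, hrel, mul_zero]
    · simp [D, hl]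
  have hsol : selectionMatrix sel * (1 - G)⁻¹ * (1 - (G + D.map invSubst)) =
      selectionMatrix sel := by
    rw [← sub_sub, Matrix.mul_sub, Matrix.mul_assoc, Matrix.mul_assoc, hTD, sub_zero,
      Matrix.nonsing_inv_mul _ ((Matrix.isUnit_iff_isUnit_det _).1 hunit), Matrix.mul_one]
  have hdata : selectionMatrix sel * (1 - G)⁻¹ =
      selectionMatrix sel * (1 - (G + D.map invSubst))⁻¹ := by
    conv_rhs => rw [← hsol]
    rw [Matrix.mul_assoc _ _ (1 - (G + D.map invSubst))⁻¹,
      Matrix.mul_nonsing_inv _ ((Matrix.isUnit_iff_isUnit_det _).1 hnet.isUnit), Matrix.mul_one]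
  have hji := hid _ hnet hdata j hj
  rw [Matrix.add_apply, left_eq_add, Matrix.map_apply, hDx] at hji
  have hcne : invSubst (C c) ≠ 0 := invSubst_ne_zero (C_ne_zero.2 hc.ne')
  exact (mul_eq_zero.1 hji).resolve_left (mul_ne_zero hcne hq)

end Identifiability

/-! ### The equivalence -/

/-- The parametrization with transfer functions `κ z⁻¹`. -/
def delayParametrization {V : Type*} (Γ : Digraph V) : TFParametrization Γ where
  p _ := 1
  n _ := 0

theorem delayParametrization_entry {V : Type*} {Γ : Digraph V}
    (P : (delayParametrization Γ).Index → ℝ) (e : GraphEdge Γ) :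
    (delayParametrization Γ).entry P e =
      invSubst (C ((delayParametrization Γ).kappa P e) * X) := by
  have hempty : IsEmpty (Fin ((delayParametrization Γ).n e)) := Fin.isEmpty
  have hn : (delayParametrization Γ).n e = 0 := rfl
  have hp : (delayParametrization Γ).p e = 1 := rfl
  rw [TFParametrization.entry, Finset.univ_eq_empty, Finset.sum_empty, Finset.sum_empty, hn, hp]
  simp [invSubst]

/-- Necessity of the path conditions. Identifiability is used only for the parametrization `κ z⁻¹`
and at a single small parameter vector where all the ranks involved have their generic values. -/
theorem maxDisjointPaths_of_holdsGenerically {V : Type*} [Fintype V] [DecidableEq V]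
    {Γ : Digraph V} {m : ℕ} {sel : Fin m → V} {i : V} {N : Finset V} (hN : N ⊆ outNbrs Γ i)
    (h : HoldsGenerically Γ (EdgesIdentifiable Γ sel i N)) :
    maxDisjointPaths Γ N (Finset.univ.image sel) = N.card ∧
      maxDisjointPaths Γ (outNbrs Γ i) (Finset.univ.image sel) =
        N.card + maxDisjointPaths Γ (outNbrs Γ i \ N) (Finset.univ.image sel) := by
  classical
  let π := delayParametrization Γ
  -- row sums of entries of norm at most `2 * ε` stay below one
  let ε : ℝ := 1 / (2 * (Fintype.card V + 1))
  have hε : 0 < ε := by positivity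
  have hεV : 2 * ε * Fintype.card V < 1 := by
    have : (0 : ℝ) < Fintype.card V + 1 := by positivity
    simp only [ε]
    field_simp
    linarith
  have hgood := (((h π).and π.ae_isUnit).and (π.ae_measuredRank_eq sel N)).and
    ((π.ae_measuredRank_eq sel (outNbrs Γ i)).and (π.ae_measuredRank_eq sel (outNbrs Γ i \ N)))
  -- almost every parameter is good, so there are arbitrarily small good ones
  obtain ⟨P, ⟨⟨⟨hid, hunit⟩, hN'⟩, hout, hB⟩, hP⟩ :=
    (Measure.dense_of_ae hgood).exists_dist_lt 0 hε
  let H : Matrix V V ℝ[X] := Matrix.of fun k j =>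
    if h : Γ.Adj j k then C (π.kappa P ⟨(j, k), h⟩) * X else 0
  have hGH : π.toMatrix P = H.map invSubst := by
    ext k j
    by_cases hjk : Γ.Adj j k
    · simp only [TFParametrization.toMatrix, H, hjk, dif_pos, Matrix.map_apply, Matrix.of_apply]
      exact delayParametrization_entry P _
    · simp [TFParametrization.toMatrix, H, hjk]
  have hkappa : ∀ e, |π.kappa P e| ≤ ε := by
    intro e
    rw [dist_comm, dist_zero_right] at hP
    exact (norm_le_pi_norm P _).trans hP.le
  have hcoeff : ∀ y z : V → RatFunc ℝ,
      ∑ v ∈ N, y v • (fun r => (1 - π.toMatrix P)⁻¹ (sel r) v) +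
        ∑ v ∈ outNbrs Γ i \ N, z v • (fun r => (1 - π.toMatrix P)⁻¹ (sel r) v) = 0 →
      ∀ v ∈ N, y v = 0 := by
    intro y z hyz v hv
    -- both sums together form one relation, with coefficient `y v` at `v ∈ N`
    let x : V → RatFunc ℝ := fun u =>
      (if u ∈ N then y u else 0) + if u ∈ outNbrs Γ i \ N then z u else 0
    have hx0 := coeff_eq_zero_of_edgesIdentifiable (x := x) hid hunit hGH ?_ hε hεV ?_ ?_ ?_ v hv
    · simpa [x, hv] using hx0
    · intro j k hjk
      simp [H, hjk]
    · intro w hw k j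
      by_cases hjk : Γ.Adj j k
      · simp only [H, Matrix.of_apply, hjk, dif_pos, map_mul, aeval_C, aeval_X, norm_mul,
          norm_algebraMap', Real.norm_eq_abs]
        exact (mul_le_of_le_one_right (abs_nonneg _) hw).trans (hkappa _)
      · simp [H, hjk, hε.le]
    · intro u hu
      have hu' : u ∉ outNbrs Γ i := by simpa [outNbrs] using hu
      have hu'' : u ∉ N := fun h' => hu' (hN h')
      simp [x, hu', hu'']
    · intro r
      have := congrFun hyz r
      simp_rw [mul_comm ((1 - π.toMatrix P)⁻¹ (sel r) _)]
      simpa [x, add_mul, Finset.sum_add_distrib, Finset.sum_ite_mem, -Finset.mem_sdiff] using this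
  have hrank := finrank_span_union_of_coeff_eq_zero (K := RatFunc ℝ)
    (fun v r => (1 - π.toMatrix P)⁻¹ (sel r) v) N (outNbrs Γ i \ N) hcoeff
  rw [Finset.union_sdiff_of_subset hN] at hrank
  rw [← hN', ← hout, ← hB]
  exact hrank

/-- Sufficiency. The condition on the paths from `N` alone is not needed here, since it follows from
the other one. -/
theorem holdsGenerically_of_maxDisjointPaths {V : Type*} [Fintype V] [DecidableEq V]
    {Γ : Digraph V} {m : ℕ} {sel : Fin m → V} {i : V} {N : Finset V} (hN : N ⊆ outNbrs Γ i)
    (h : maxDisjointPaths Γ (outNbrs Γ i) (Finset.univ.image sel) =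
      N.card + maxDisjointPaths Γ (outNbrs Γ i \ N) (Finset.univ.image sel)) :
    HoldsGenerically Γ (EdgesIdentifiableAmongSolutions Γ sel i N) := by
  intro π
  filter_upwards [π.ae_isUnit, π.ae_measuredRank_eq sel (outNbrs Γ i),
    π.ae_measuredRank_eq sel (outNbrs Γ i \ N)] with P hunit hout hB
  refine edgesIdentifiableAmongSolutions_of_measuredRank hN (π.isConsistent_toMatrix P) hunit ?_
  rw [hout, hB, h]

theorem HoldsGenerically.mono {V : Type*} [Fintype V] {Γ : Digraph V}
    {Q Q' : Matrix V V (RatFunc ℝ) → Prop} (h : HoldsGenerically Γ Q) (hQ : ∀ G, Q G → Q' G) :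
    HoldsGenerically Γ Q' :=
  fun π => (h π).mono fun _ hP => hQ _ hP

theorem mainTheorem1 {V : Type*} [Fintype V] [DecidableEq V] (Γ : Digraph V)
    (hΓ : ∀ v, ¬ Γ.Adj v v) {m : ℕ} (sel : Fin m → V) (𝒞 : Finset V)
    (h𝒞 : 𝒞 = Finset.univ.image sel) (i : V) (N : Finset V) (hN : N ⊆ outNbrs Γ i) :
    (HoldsGenerically Γ (EdgesIdentifiable Γ sel i N) ↔
      maxDisjointPaths Γ N 𝒞 = N.card ∧
      maxDisjointPaths Γ (outNbrs Γ i) 𝒞 =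
        N.card + maxDisjointPaths Γ (outNbrs Γ i \ N) 𝒞) ∧
    (HoldsGenerically Γ (EdgesIdentifiableAmongSolutions Γ sel i N) ↔
      maxDisjointPaths Γ N 𝒞 = N.card ∧
      maxDisjointPaths Γ (outNbrs Γ i) 𝒞 =
        N.card + maxDisjointPaths Γ (outNbrs Γ i \ N) 𝒞) := by
  subst h𝒞
  have hmono : HoldsGenerically Γ (EdgesIdentifiableAmongSolutions Γ sel i N) →
      HoldsGenerically Γ (EdgesIdentifiable Γ sel i N) :=
    fun h => h.mono fun _ hG => hG.edgesIdentifiable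
  exact ⟨⟨maxDisjointPaths_of_holdsGenerically hN,
      fun h => hmono (holdsGenerically_of_maxDisjointPaths hN h.2)⟩,
    ⟨fun h => maxDisjointPaths_of_holdsGenerically hN (hmono h),
      fun h => holdsGenerically_of_maxDisjointPaths hN h.2⟩⟩
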